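/- Let $T>0$, $d,q\in\mathbb{N}$, $x\in\mathbb{R}^d$, and let $b:[0,T]\times\mathbb{R}^d\to\mathbb{R}^d$ and $\sigma:[0,T]\times\mathbb{R}^d\to\mathcal{M}(d\times q)$ be continuous. Let $(\Omega,\mathcal{A},(\mathcal{F}_t)_{t\in[0,T]},\mathbb{P})$ be a filtered probability space carrying a standard $q$-dimensional $\mathcal{F}_t$-Brownian motion $W$ on $[0,T]$, and let $X=(X_t)_{t\in[0,T]}$ be a strong solution of $$dX_t=b(t,X_t)\,dt+\sigma(t,X_t)\,dW_t,\qquad X_0=x.$$ For an integer $m\ge 1$ put $t_k=kT/m$ and $U_k=\sqrt{m/T}\,(W_{kT/m}-W_{(k-1)T/m})$, $k=1,\dots,m$. The Euler scheme with step $T/m$ driven by $W$ is the process $\bar X^{[m]}$ given by $\bar X^{[m]}_0=x$, $$\bar X^{[m]}_{t_{k+1}}=\bar X^{[m]}_{t_k}+\frac Tm\,b(t_k,\bar X^{[m]}_{t_k})+\sqrt{\frac Tm}\,\sigma(t_k,\bar X^{[m]}_{t_k})\,U_{k+1},\qquad 0\le k<m,$$ and $\bar X^{[m]}_t=\bar X^{[m]}_{t_k}$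 for $t\in[t_k,t_{k+1})$. Assume that for every $p\in[1,\infty)$ the Euler scheme converges to $X$ in $L^p(\mathbb{P})$ for the sup-norm over $[0,T]$, i.e. $\sup_{t\in[0,T]}|X_t|\in L^p(\mathbb{P})$ and $\big\|\sup_{t\in[0,T]}|\bar X^{[n]}_t-X_t|\big\|_{L^p(\mathbb{P})}\to0$ as $n\to\infty$. Let $V$ be a real vector space, stable by product, of continuous functions $f:\mathbb{R}^d\to\mathbb{R}$ with polynomial growth, which is characterizing: whenever $Y,Z$ are $\mathbb{R}^d$-valued random vectors on a common probability space such that $f(Y)=f(Z)$ a.s. for every $f\in V$, then $Y=Z$ a.s. Let $R\ge1$ be an integer, and assume that for every $f\in V$ there are real constants $c_1,\dots,c_{R-1}$, not depending on $n$, such that $$\mathbb{E}f(X_T)=\mathbb{E}f(\bar X^{[n]}_T)+\sum_{k=1}^{R-1}\frac{c_k}{n^k}+O(n^{-R})\qquad(n\to\infty).$$ For $1\le r\le R$ let $$\alpha_r=(-1)^{R-r}\frac{r^R}{r!\,(R-r)!},$$ and let $\bar X^{(r)}=\bar X^{[rn]}$ be the Euler scheme with step $T/(rn)$, all $R$ schemes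 being driven by the same Brownian motion $W$. Then for every $f\in V$ the variables $f(X_T)$ and, for $n$ large enough, $f(\bar X^{(r)}_T)$, $1\le r\le R$, are square integrable, and, as $n\to\infty$, $$\mathbb{E}\Big(\sum_{r=1}^R\alpha_r f(\bar X^{(r)}_T)\Big)=\mathbb{E}f(X_T)+O(n^{-R})\qquad\text{and}\qquad \mathrm{Var}\Big(\sum_{r=1}^R\alpha_r f(\bar X^{(r)}_T)\Big)\longrightarrow\mathrm{Var}(f(X_T)).$$ -/

import Mathlib

open MeasureTheory ProbabilityTheory Filter Topology Asymptotics
open scoped ENNReal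

universe u

noncomputable section

namespace RichardsonRomberg

/-- Euclidean space `ℝ^d`. -/
abbrev E (d : ℕ) : Type := EuclideanSpace ℝ (Fin d)

/-- `W` is, on `[0, T]`, a standard `q`-dimensional Brownian motion with respect to the filtration
`F`. Only the values of `F` and `W` at times in `[0, T]` matter. -/
structure IsBrownianMotion {Ω : Type u} {mΩ : MeasurableSpace Ω} {q : ℕ} (T : ℝ)
    (F : Filtration ℝ mΩ) (W : ℝ → Ω → E q) (μ : Measure Ω) : Prop where
  adapted : ∀ t ∈ Set.Icc 0 T, Measurable[F t] (W t)
  zero : ∀ᵐ ω ∂μ, W 0 ω = 0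
  increment_law : ∀ s t : ℝ, 0 ≤ s → s ≤ t → t ≤ T →
    HasLaw (fun ω => W t ω - W s ω) ((stdGaussian (E q)).map (fun z => √(t - s) • z)) μ
  increment_indep : ∀ s t : ℝ, 0 ≤ s → s ≤ t → t ≤ T →
    Indep (MeasurableSpace.comap (fun ω => W t ω - W s ω) inferInstance) (F s) μ
  continuous_paths : ∀ᵐ ω ∂μ, ContinuousOn (fun t => W t ω) (Set.Icc 0 T)

/-- A matrix-valued step process `∑_{k < n} ξ_k 1_{(t_k, t_{k+1}]}` on `[0, T]`, where each `ξ_k` is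
bounded and `F_{t_k}`-measurable. -/
structure StepProcess {Ω : Type u} {mΩ : MeasurableSpace Ω} (d q : ℕ) (T : ℝ)
    (F : Filtration ℝ mΩ) where
  n : ℕ
  time : ℕ → ℝ
  time_mono : Monotone time
  time_mem : ∀ k, time k ∈ Set.Icc 0 T
  coef : ℕ → Ω → Matrix (Fin d) (Fin q) ℝ
  coef_measurable : ∀ k i j, Measurable[F (time k)] (fun ω => coef k ω i j)
  coef_bounded : ∀ k, ∃ C : ℝ, ∀ ω i j, |coef k ω i j| ≤ C

namespace StepProcess

variable {Ω : Type u} {mΩ : MeasurableSpace Ω} {d q : ℕ} {T : ℝ} {F : Filtration ℝ mΩ}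

/-- The value of a step process at time `s`. -/
def val (S : StepProcess d q T F) (s : ℝ) (ω : Ω) : Matrix (Fin d) (Fin q) ℝ :=
  ∑ k ∈ Finset.range S.n,
    (Set.Ioc (S.time k) (S.time (k + 1))).indicator (fun _ => S.coef k ω) s

/-- The elementary stochastic integral
`∫_0^t S dW = ∑_{k < n} ξ_k (W_{t_{k+1} ∧ t} - W_{t_k ∧ t})`. -/
def integral (S : StepProcess d q T F) (W : ℝ → Ω → E q) (t : ℝ) (ω : Ω) : E d :=
  ∑ k ∈ Finset.range S.n,
    Matrix.toEuclideanLin (S.coef k ω)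
      (W (min (S.time (k + 1)) t) ω - W (min (S.time k) t) ω)

end StepProcess

/-- `I` is (a version of) the Itô integral process `t ↦ ∫_0^t H_s dW_s` on `[0, T]`: there are step
processes `S_m` such that `∫_0^T |S_m(s) - H_s|² ds → 0` in probability, with `|·|` the Frobenius
norm, and `sup_{t ∈ [0, T]} |∫_0^t S_m dW - I_t| → 0` in probability. -/
def IsItoIntegral {Ω : Type u} {mΩ : MeasurableSpace Ω} {d q : ℕ} (T : ℝ)
    (F : Filtration ℝ mΩ) (W : ℝ → Ω → E q) (μ : Measure Ω)
    (H : ℝ → Ω → Matrix (Fin d) (Fin q) ℝ) (I : ℝ → Ω → E d) : Prop :=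
  ∃ S : ℕ → StepProcess d q T F,
    (∀ ε : ℝ≥0∞, 0 < ε → Tendsto (fun m => μ {ω | ε ≤ ∫⁻ s in Set.Icc 0 T,
      ENNReal.ofReal (∑ i, ∑ j, ((S m).val s ω i j - H s ω i j) ^ 2)}) atTop (𝓝 0)) ∧
    (∀ ε : ℝ≥0∞, 0 < ε → Tendsto (fun m => μ {ω | ε ≤
      ⨆ t ∈ Set.Icc 0 T, ‖(S m).integral W t ω - I t ω‖ₑ}) atTop (𝓝 0))

/-- `X` is a strong solution on `[0, T]` of `dX_t = b(t, X_t) dt + σ(t, X_t) dW_t`, `X_0 = x`: it has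
continuous paths, satisfies the integral equation, and is adapted to the completed filtration
generated by `W` (each `X_t` is almost surely equal to a `σ(W_s, s ∈ [0, t])`-measurable variable). -/
structure IsStrongSolution {Ω : Type u} {mΩ : MeasurableSpace Ω} {d q : ℕ} (T : ℝ)
    (F : Filtration ℝ mΩ) (W : ℝ → Ω → E q) (μ : Measure Ω)
    (b : ℝ → E d → E d) (σ : ℝ → E d → Matrix (Fin d) (Fin q) ℝ) (x : E d)
    (X : ℝ → Ω → E d) : Prop where
  continuous_paths : ∀ᵐ ω ∂μ, ContinuousOn (fun t => X t ω) (Set.Icc 0 T)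
  adapted : ∀ t ∈ Set.Icc 0 T,
    AEStronglyMeasurable[⨆ s ∈ Set.Icc 0 t, MeasurableSpace.comap (W s) inferInstance] (X t) μ
  integral_eq : ∃ I : ℝ → Ω → E d,
    IsItoIntegral T F W μ (fun s ω => σ s (X s ω)) I ∧
    ∀ᵐ ω ∂μ, ∀ t ∈ Set.Icc 0 T, X t ω = x + (∫ s in (0 : ℝ)..t, b s (X s ω)) + I t ω

/-- The white noise `U_k = √(m/T) (W_{kT/m} - W_{(k-1)T/m})`, `k ≥ 1`, for the step `T/m`. -/
def whiteNoise {Ω : Type u} {q : ℕ} (T : ℝ) (W : ℝ → Ω → E q) (m k : ℕ) (ω : Ω) : E q :=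
  √((m : ℝ) / T) • (W ((k : ℝ) * T / m) ω - W (((k : ℝ) - 1) * T / m) ω)

/-- The Euler scheme with step `T/m` and noise `U`, at the grid points `t_k = kT/m`. -/
def eulerGrid {Ω : Type u} {d q : ℕ} (T : ℝ) (b : ℝ → E d → E d)
    (σ : ℝ → E d → Matrix (Fin d) (Fin q) ℝ) (x : E d) (m : ℕ) (U : ℕ → Ω → E q) :
    ℕ → Ω → E d
  | 0 => fun _ => x
  | k + 1 => fun ω =>
      eulerGrid T b σ x m U k ω
        + (T / m) • b ((k : ℝ) * T / m) (eulerGrid T b σ x m U k ω)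
        + Matrix.toEuclideanLin (σ ((k : ℝ) * T / m) (eulerGrid T b σ x m U k ω))
            (√(T / m) • U (k + 1) ω)

/-- The stepwise constant Brownian Euler scheme with step `T/m`: at time `t ∈ [t_k, t_{k+1})` it
takes the value at the grid point `t_k`; at time `T` it takes the value at `t_m = T`. -/
def euler {Ω : Type u} {d q : ℕ} (T : ℝ) (b : ℝ → E d → E d)
    (σ : ℝ → E d → Matrix (Fin d) (Fin q) ℝ) (x : E d) (W : ℝ → Ω → E q) (m : ℕ)
    (t : ℝ) (ω : Ω) : E d :=
  eulerGrid T b σ x m (whiteNoise T W m) ⌊t * m / T⌋₊ ω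

/-- Convergence of a sequence of processes to `X` in `L^p(μ)` for the sup-norm over `[0, T]`. -/
def TendstoLpSup {Ω : Type u} {mΩ : MeasurableSpace Ω} {d : ℕ} (T : ℝ) (μ : Measure Ω)
    (p : ℝ≥0∞) (Y : ℕ → ℝ → Ω → E d) (X : ℝ → Ω → E d) : Prop :=
  eLpNorm (fun ω => ⨆ t ∈ Set.Icc 0 T, ‖X t ω‖ₑ) p μ < ∞ ∧
  Tendsto (fun n => eLpNorm (fun ω => ⨆ t ∈ Set.Icc 0 T, ‖Y n t ω - X t ω‖ₑ) p μ) atTop (𝓝 0)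

/-- `V` is characterizing for almost sure equality of random vectors. -/
def IsCharacterizing {d : ℕ} (V : Submodule ℝ (E d → ℝ)) : Prop :=
  ∀ (Ω : Type u) [MeasurableSpace Ω] (μ : Measure Ω) (Y Z : Ω → E d),
    IsProbabilityMeasure μ → Measurable Y → Measurable Z →
    (∀ f ∈ V, ∀ᵐ ω ∂μ, f (Y ω) = f (Z ω)) → ∀ᵐ ω ∂μ, Y ω = Z ω

/-- Polynomial growth. -/
def HasPolynomialGrowth {d : ℕ} (f : E d → ℝ) : Prop :=
  ∃ (C : ℝ) (m : ℕ), ∀ y, |f y| ≤ C * (1 + ‖y‖ ^ m)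

/-- The expansion of order `R` of the weak error on `V`: for each `f ∈ V` there are constants `c_k`
with `𝔼 f(Z) = 𝔼 f(Y_n) + ∑_{k=1}^{R-1} c_k n^{-k} + O(n^{-R})` as `n → ∞`. -/
def HasWeakExpansion {Ω : Type u} {mΩ : MeasurableSpace Ω} {d : ℕ} (μ : Measure Ω)
    (V : Submodule ℝ (E d → ℝ)) (R : ℕ) (Y : ℕ → Ω → E d) (Z : Ω → E d) : Prop :=
  ∀ f ∈ V, ∃ c : ℕ → ℝ,
    (fun n : ℕ => (∫ ω, f (Z ω) ∂μ) - (∫ ω, f (Y n ω) ∂μ)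
      - ∑ k ∈ Finset.Icc 1 (R - 1), c k / (n : ℝ) ^ k)
      =O[atTop] fun n : ℕ => ((n : ℝ) ^ R)⁻¹

/-- The weights `α_r = (-1)^{R-r} r^R / (r! (R-r)!)`, for `1 ≤ r ≤ R`. -/
def weight (R r : ℕ) : ℝ :=
  (-1) ^ (R - r) * (r : ℝ) ^ R / ((r.factorial : ℝ) * ((R - r).factorial : ℝ))

/-- The combination `∑_{r=1}^R α_r f(X̄^{(r)}_T)`, where `X̄^{(r)}` is the Euler scheme with step
`T/(rn)`, all `R` schemes being driven by the same Brownian motion `W`. -/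
def multistep {Ω : Type u} {d q : ℕ} (T : ℝ) (b : ℝ → E d → E d)
    (σ : ℝ → E d → Matrix (Fin d) (Fin q) ℝ) (x : E d) (W : ℝ → Ω → E q)
    (R : ℕ) (f : E d → ℝ) (n : ℕ) (ω : Ω) : ℝ :=
  ∑ r ∈ Finset.Icc 1 R, weight R r * f (euler T b σ x W (r * n) T ω)

end RichardsonRomberg

end

/-!
The weights solve the Vandermonde system `∑ α_r r^{-k} = 0` for `1 ≤ k < R`, `∑ α_r = 1`, because
`R! ∑ α_r r^{-k}` is the `R`-th forward difference at `0` of the monomial `y ^ (R - k)`. Combining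
the weak error expansions at `r n` thus cancels every term `c_k / n ^ k`.

For the variance, polynomial growth of `f` and convergence of the schemes in a high enough `L^p`
make `|f(X̄^{[n]}_T)|²` uniformly integrable, so `f(X̄^{[n]}_T) → f(X_T)` in `L²` (Vitali).
As all `R` schemes are driven by the same Brownian motion they share this limit, and since the
weights sum to `1` the combination also tends to `f(X_T)` in `L²`.
-/

namespace RichardsonRomberg

theorem sum_neg_one_pow_mul_choose_mul_pow {R j : ℕ} (hj : j ≤ R) :
    ∑ r ∈ Finset.range (R + 1), (-1 : ℝ) ^ (R - r) * R.choose r * (r : ℝ) ^ j =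
      if j = R then (R.factorial : ℝ) else 0 := by
  have hdiff := fwdDiff_iter_eq_sum_shift (1 : ℝ) (fun y : ℝ => y ^ j) R 0
  simp only [zero_add, nsmul_eq_mul, mul_one, zsmul_eq_mul] at hdiff
  push_cast at hdiff
  rw [← hdiff]
  split_ifs with h
  · rw [h, fwdDiff_iter_eq_factorial, Pi.natCast_apply]
  · rw [fwdDiff_iter_pow_eq_zero_of_lt (lt_of_le_of_ne hj h), Pi.zero_apply]

theorem weight_div_pow {R r k : ℕ} (hr : r ∈ Finset.Icc 1 R) (hk : k ≤ R) :
    weight R r / (r : ℝ) ^ k =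
      (-1 : ℝ) ^ (R - r) * R.choose r * (r : ℝ) ^ (R - k) / R.factorial := by
  obtain ⟨hr1, hrR⟩ := Finset.mem_Icc.mp hr
  rw [weight, Nat.cast_choose ℝ hrR, ← pow_sub_mul_pow (r : ℝ) hk]
  field_simp

theorem sum_weight_div_pow {R k : ℕ} (hk : k < R) :
    ∑ r ∈ Finset.Icc 1 R, weight R r / (r : ℝ) ^ k = if k = 0 then 1 else 0 := by
  have hdiff := sum_neg_one_pow_mul_choose_mul_pow (Nat.sub_le R k)
  rw [Finset.sum_range_eq_add_Ico _ R.add_one_pos, Nat.cast_zero,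
    zero_pow (Nat.sub_ne_zero_of_lt hk), mul_zero, zero_add,
    Finset.Ico_add_one_right_eq_Icc] at hdiff
  rw [Finset.sum_congr rfl fun r hr => weight_div_pow hr hk.le, ← Finset.sum_div, hdiff, ite_div,
    div_self (by positivity), zero_div]
  exact if_congr (by omega) rfl rfl

theorem sum_weight {R : ℕ} (hR : 1 ≤ R) : ∑ r ∈ Finset.Icc 1 R, weight R r = 1 := by
  simpa using sum_weight_div_pow (k := 0) hR

theorem sum_weight_mul_sum_div_pow (R : ℕ) (c : ℕ → ℝ) (t : ℝ) :
    ∑ r ∈ Finset.Icc 1 R,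
      weight R r * ∑ k ∈ Finset.Icc 1 (R - 1), c k / (r * t) ^ k = 0 := by
  simp_rw [Finset.mul_sum]
  rw [Finset.sum_comm]
  refine Finset.sum_eq_zero fun k hk => ?_
  obtain ⟨hk1, hkR⟩ := Finset.mem_Icc.mp hk
  calc ∑ r ∈ Finset.Icc 1 R, weight R r * (c k / (r * t) ^ k)
      = ∑ r ∈ Finset.Icc 1 R, c k / t ^ k * (weight R r / (r : ℝ) ^ k) :=
        Finset.sum_congr rfl fun r _ => by rw [mul_pow]; ring
    _ = 0 := by
        rw [← Finset.mul_sum, sum_weight_div_pow (by omega), if_neg (by omega), mul_zero]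

theorem isBigO_inv_pow_comp_mul_left {G : Type*} [NormedAddCommGroup G] {e : ℕ → G} {R r : ℕ}
    (he : e =O[atTop] fun n : ℕ => ((n : ℝ) ^ R)⁻¹) (hr : r ≠ 0) :
    (fun n => e (r * n)) =O[atTop] fun n : ℕ => ((n : ℝ) ^ R)⁻¹ := by
  refine (he.comp_tendsto (tendsto_id.const_mul_atTop' (Nat.pos_of_ne_zero hr))).trans ?_
  refine IsBigO.of_bound' ((eventually_gt_atTop 0).mono fun n hn => ?_)
  simp only [Function.comp_apply, id_eq, norm_inv, norm_pow, Real.norm_natCast]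
  gcongr
  exact Nat.le_mul_of_pos_left n (Nat.pos_of_ne_zero hr)

theorem isBigO_sum_weight_mul_sub {R : ℕ} (hR : 1 ≤ R) {a : ℕ → ℝ} {l : ℝ} {c : ℕ → ℝ}
    (h : (fun n : ℕ => l - a n - ∑ k ∈ Finset.Icc 1 (R - 1), c k / (n : ℝ) ^ k)
      =O[atTop] fun n : ℕ => ((n : ℝ) ^ R)⁻¹) :
    (fun n : ℕ => ∑ r ∈ Finset.Icc 1 R, weight R r * a (r * n) - l)
      =O[atTop] fun n : ℕ => ((n : ℝ) ^ R)⁻¹ := by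
  set e : ℕ → ℝ := fun n => l - a n - ∑ k ∈ Finset.Icc 1 (R - 1), c k / (n : ℝ) ^ k with he
  have hsum (n : ℕ) : ∑ r ∈ Finset.Icc 1 R, weight R r * a (r * n) - l =
      -∑ r ∈ Finset.Icc 1 R, weight R r * e (r * n) := by
    simp only [he, mul_sub, Finset.sum_sub_distrib, ← Finset.sum_mul, sum_weight hR, one_mul,
      Nat.cast_mul, sum_weight_mul_sum_div_pow, sub_zero, neg_sub]
  simp_rw [hsum]
  refine IsBigO.neg_left (IsBigO.fun_sum fun r hr => IsBigO.const_mul_left ?_ _)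
  exact isBigO_inv_pow_comp_mul_left h (Nat.one_le_iff_ne_zero.mp (Finset.mem_Icc.mp hr).1)

theorem tendstoInMeasure_continuous_comp {Ω G H : Type*} {mΩ : MeasurableSpace Ω} {μ : Measure Ω}
    [IsFiniteMeasure μ] [PseudoEMetricSpace G] [PseudoEMetricSpace H] {Y : ℕ → Ω → G} {X : Ω → G}
    (hY : ∀ n, AEStronglyMeasurable (Y n) μ) (hYX : TendstoInMeasure μ Y atTop X)
    {f : G → H} (hf : Continuous f) :
    TendstoInMeasure μ (fun n ω => f (Y n ω)) atTop (fun ω => f (X ω)) := by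
  refine (exists_seq_tendstoInMeasure_atTop_iff
    fun n => hf.comp_aestronglyMeasurable (hY n)).mpr fun ns hns => ?_
  obtain ⟨ns', hns', hlim⟩ := (hYX.comp hns.tendsto_atTop).exists_seq_tendsto_ae
  exact ⟨ns', hns', hlim.mono fun ω hω => (hf.tendsto _).comp hω⟩

section LpConvergence

variable {Ω ι G : Type*} {mΩ : MeasurableSpace Ω} {μ : Measure Ω} [NormedAddCommGroup G]
  {l : Filter ι} {S : ι → Ω → G} {Z : Ω → G} {p : ℝ≥0∞}

theorem eventually_memLp_of_tendsto_eLpNorm (hS : ∀ i, AEStronglyMeasurable (S i) μ)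
    (hZ : MemLp Z p μ) (hSZ : Tendsto (fun i => eLpNorm (S i - Z) p μ) l (𝓝 0)) :
    ∀ᶠ i in l, MemLp (S i) p μ := by
  filter_upwards [hSZ.eventually_lt_const zero_lt_one] with i hi
  have hdiff : MemLp (S i - Z) p μ := ⟨(hS i).sub hZ.1, hi.trans ENNReal.one_lt_top⟩
  simpa using hdiff.add hZ

theorem tendsto_eLpNorm_of_tendsto_eLpNorm_sub (hp : 1 ≤ p)
    (hS : ∀ i, AEStronglyMeasurable (S i) μ) (hZ : MemLp Z p μ)
    (hSZ : Tendsto (fun i => eLpNorm (S i - Z) p μ) l (𝓝 0)) :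
    Tendsto (fun i => eLpNorm (S i) p μ) l (𝓝 (eLpNorm Z p μ)) := by
  have hlower : Tendsto (fun i => eLpNorm Z p μ - eLpNorm (S i - Z) p μ) l (𝓝 (eLpNorm Z p μ)) := by
    simpa using ENNReal.Tendsto.sub tendsto_const_nhds hSZ (Or.inl hZ.eLpNorm_ne_top)
  have hupper : Tendsto (fun i => eLpNorm (S i - Z) p μ + eLpNorm Z p μ) l (𝓝 (eLpNorm Z p μ)) := by
    simpa using hSZ.add_const (eLpNorm Z p μ)
  refine tendsto_of_tendsto_of_tendsto_of_le_of_le hlower hupper (fun i => ?_) fun i => ?_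
  · rw [tsub_le_iff_right]
    simpa using eLpNorm_sub_le (hS i) ((hS i).sub hZ.1) hp
  · simpa using eLpNorm_add_le ((hS i).sub hZ.1) hZ.1 hp

theorem tendsto_integral_of_tendsto_eLpNorm [NormedSpace ℝ G] [IsProbabilityMeasure μ]
    (hp : 1 ≤ p) (hS : ∀ i, AEStronglyMeasurable (S i) μ) (hZ : MemLp Z p μ)
    (hSZ : Tendsto (fun i => eLpNorm (S i - Z) p μ) l (𝓝 0)) :
    Tendsto (fun i => ∫ ω, S i ω ∂μ) l (𝓝 (∫ ω, Z ω ∂μ)) := by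
  refine tendsto_integral_of_L1' Z hZ.1
    ((eventually_memLp_of_tendsto_eLpNorm hS hZ hSZ).mono fun i hi => hi.integrable hp) ?_
  exact tendsto_of_tendsto_of_tendsto_of_le_of_le tendsto_const_nhds hSZ (fun _ => zero_le)
    fun i => eLpNorm_le_eLpNorm_of_exponent_le hp ((hS i).sub hZ.1)

theorem tendsto_eLpNorm_sum_smul_sub {κ : Type*} [NormedSpace ℝ G] (hp : 1 ≤ p) {s : Finset κ}
    {w : κ → ℝ} (hw : ∑ r ∈ s, w r = 1) {Y : κ → ι → Ω → G}
    (hY : ∀ r ∈ s, ∀ i, AEStronglyMeasurable (Y r i) μ) (hZ : AEStronglyMeasurable Z μ)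
    (hYZ : ∀ r ∈ s, Tendsto (fun i => eLpNorm (Y r i - Z) p μ) l (𝓝 0)) :
    Tendsto (fun i => eLpNorm (∑ r ∈ s, w r • Y r i - Z) p μ) l (𝓝 0) := by
  have hdecomp (i : ι) : ∑ r ∈ s, w r • Y r i - Z = ∑ r ∈ s, w r • (Y r i - Z) := by
    simp only [smul_sub, Finset.sum_sub_distrib, ← Finset.sum_smul, hw, one_smul]
  have hbound : Tendsto (fun i => ∑ r ∈ s, ‖w r‖ₑ * eLpNorm (Y r i - Z) p μ) l (𝓝 0) := by
    rw [← Finset.sum_const_zero (s := s)]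
    refine tendsto_finsetSum _ fun r hr => ?_
    simpa using ENNReal.Tendsto.const_mul (hYZ r hr) (Or.inr enorm_ne_top)
  refine tendsto_of_tendsto_of_tendsto_of_le_of_le tendsto_const_nhds hbound
    (fun _ => zero_le) fun i => ?_
  rw [hdecomp]
  refine (eLpNorm_sum_le (fun r hr => ((hY r hr i).sub hZ).const_smul _) hp).trans ?_
  exact Finset.sum_le_sum fun r _ => (eLpNorm_const_smul _ _ _ _).le

end LpConvergence

section Variance

variable {Ω ι : Type*} {mΩ : MeasurableSpace Ω} {μ : Measure Ω}

theorem evariance_eq_eLpNorm_sub_integral_sq (Z : Ω → ℝ) :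
    evariance Z μ = eLpNorm (Z - fun _ => ∫ ω, Z ω ∂μ) 2 μ ^ 2 := by
  have h := eLpNorm_nnreal_pow_eq_lintegral (f := Z - fun _ => ∫ ω, Z ω ∂μ) (μ := μ)
    (two_ne_zero (α := NNReal))
  simp only [NNReal.coe_ofNat, ENNReal.coe_ofNat, ENNReal.rpow_ofNat, Pi.sub_apply] at h
  exact h.symm

theorem tendsto_variance_of_tendsto_eLpNorm [IsProbabilityMeasure μ] {l : Filter ι}
    {S : ι → Ω → ℝ} {Z : Ω → ℝ} (hS : ∀ i, AEStronglyMeasurable (S i) μ) (hZ : MemLp Z 2 μ)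
    (hSZ : Tendsto (fun i => eLpNorm (S i - Z) 2 μ) l (𝓝 0)) :
    Tendsto (fun i => variance (S i) μ) l (𝓝 (variance Z μ)) := by
  set mean : (Ω → ℝ) → ℝ := fun Y => ∫ ω, Y ω ∂μ
  have hmean : Tendsto (fun i => eLpNorm (fun _ : Ω => mean (S i) - mean Z) 2 μ) l (𝓝 0) := by
    have := (tendsto_integral_of_tendsto_eLpNorm one_le_two hS hZ hSZ).sub_const (mean Z)
    simpa [eLpNorm_const', mean] using this.enorm
  have hcentered : Tendsto (fun i => eLpNorm ((S i - fun _ => mean (S i)) - (Z - fun _ => mean Z))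
      2 μ) l (𝓝 0) := by
    refine tendsto_of_tendsto_of_tendsto_of_le_of_le tendsto_const_nhds
      (by simpa using hSZ.add hmean) (fun _ => zero_le) fun i => ?_
    rw [sub_sub_sub_comm]
    exact eLpNorm_sub_le ((hS i).sub hZ.1) aestronglyMeasurable_const one_le_two
  have hnorm := tendsto_eLpNorm_of_tendsto_eLpNorm_sub one_le_two
    (fun i => (hS i).sub aestronglyMeasurable_const) (hZ.sub (memLp_const (mean Z))) hcentered
  have hevariance : Tendsto (fun i => evariance (S i) μ) l (𝓝 (evariance Z μ)) := by
    simpa only [evariance_eq_eLpNorm_sub_integral_sq] using ENNReal.Tendsto.pow hnorm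
  exact (ENNReal.tendsto_toReal hZ.evariance_ne_top).comp hevariance

end Variance

section PolynomialGrowth

-- The constant is kept inside the power: the bound is then the `m`-th power of a Lipschitz function
-- of `y`, along which convergence in `L^{pm}` passes.
theorem norm_le_pow_of_polynomial_growth {G H : Type*} [NormedAddCommGroup G]
    [NormedAddCommGroup H] {f : G → H} {C : ℝ} {m : ℕ} (hm : m ≠ 0)
    (hf : ∀ y, ‖f y‖ ≤ C * (1 + ‖y‖ ^ m)) (y : G) :
    ‖f y‖ ≤ ‖max C 1 * (1 + ‖y‖)‖ ^ m := by
  have hC : C ≤ max C 1 ^ m := (le_max_left C 1).trans (le_self_pow₀ (le_max_right C 1) hm)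
  have hsum : 1 + ‖y‖ ^ m ≤ (1 + ‖y‖) ^ m := by
    simpa using pow_add_pow_le zero_le_one (norm_nonneg y) hm
  rw [Real.norm_of_nonneg (by positivity), mul_pow]
  exact (hf y).trans (by gcongr)

theorem HasPolynomialGrowth.exists_ne_zero {d : ℕ} {f : E d → ℝ} (hf : HasPolynomialGrowth f) :
    ∃ (C : ℝ) (m : ℕ), m ≠ 0 ∧ ∀ y, ‖f y‖ ≤ C * (1 + ‖y‖ ^ m) := by
  obtain ⟨C, m, hf⟩ := hf
  obtain rfl | hm := eq_or_ne m 0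
  · refine ⟨2 * |C|, 1, one_ne_zero, fun y => (hf y).trans ?_⟩
    nlinarith [le_abs_self C, mul_nonneg (abs_nonneg C) (norm_nonneg y)]
  · exact ⟨C, m, hm, hf⟩

variable {Ω G H : Type*} {mΩ : MeasurableSpace Ω} {μ : Measure Ω}
  [NormedAddCommGroup G] [NormedAddCommGroup H] {p : ℝ≥0∞} {m : ℕ}

theorem eLpNorm_le_eLpNorm_pow {g : Ω → G} {Z : Ω → H} (hm : m ≠ 0)
    (h : ∀ ω, ‖g ω‖ ≤ ‖Z ω‖ ^ m) :
    eLpNorm g p μ ≤ eLpNorm Z (p * m) μ ^ m := by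
  have hZ := eLpNorm_norm_rpow (p := p) (μ := μ) Z (q := (m : ℝ)) (by positivity)
  simp only [Real.rpow_natCast, ENNReal.rpow_natCast, ENNReal.ofReal_natCast] at hZ
  rw [← hZ]
  exact eLpNorm_mono_real h

theorem unifIntegrable_of_norm_le_pow {ι : Type*} {g : ι → Ω → G} {Z : ι → Ω → H} (hm : m ≠ 0)
    (hZ : UnifIntegrable Z (p * m) μ) (h : ∀ i ω, ‖g i ω‖ ≤ ‖Z i ω‖ ^ m) :
    UnifIntegrable g p μ := by
  intro ε hε
  obtain ⟨δ, hδ, hsmall⟩ := hZ (ε := ε ^ (m : ℝ)⁻¹) (by positivity)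
  refine ⟨δ, hδ, fun i s hs hμs => ?_⟩
  calc eLpNorm (s.indicator (g i)) p μ ≤ eLpNorm (s.indicator (Z i)) (p * m) μ ^ m := by
        refine eLpNorm_le_eLpNorm_pow hm fun ω => ?_
        by_cases hω : ω ∈ s
        · simpa [hω] using h i ω
        · simp [hω, hm]
    _ ≤ ENNReal.ofReal (ε ^ (m : ℝ)⁻¹) ^ m := by gcongr; exact hsmall i s hs hμs
    _ = ENNReal.ofReal ε := by
        rw [← ENNReal.ofReal_pow (by positivity), Real.rpow_inv_natCast_pow hε.le hm]

variable [IsFiniteMeasure μ]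

theorem memLp_const_mul_one_add_norm (K : ℝ) {Z : Ω → G} (hZ : MemLp Z p μ) :
    MemLp (fun ω => K * (1 + ‖Z ω‖)) p μ :=
  ((memLp_const (1 : ℝ)).add hZ.norm).const_mul K

theorem unifIntegrable_const_mul_one_add_norm (K : ℝ) {Y : ℕ → Ω → G} {X : Ω → G} (hp : 1 ≤ p)
    (hp_top : p ≠ ∞) (hY : ∀ n, MemLp (Y n) p μ) (hX : MemLp X p μ)
    (hYX : Tendsto (fun n => eLpNorm (Y n - X) p μ) atTop (𝓝 0)) :
    UnifIntegrable (fun n ω => K * (1 + ‖Y n ω‖)) p μ := by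
  have hlim : Tendsto (fun n => ENNReal.ofReal |K| * eLpNorm (Y n - X) p μ) atTop (𝓝 0) := by
    simpa using ENNReal.Tendsto.const_mul hYX (Or.inr ENNReal.ofReal_ne_top)
  refine unifIntegrable_of_tendsto_Lp hp hp_top (fun n => memLp_const_mul_one_add_norm K (hY n))
    (memLp_const_mul_one_add_norm K hX) <|
    tendsto_of_tendsto_of_tendsto_of_le_of_le tendsto_const_nhds hlim (fun _ => zero_le) fun n =>
      eLpNorm_le_mul_eLpNorm_of_ae_le_mul (ae_of_all _ fun ω => ?_) _
  rw [Pi.sub_apply, ← mul_sub, add_sub_add_left_eq_sub, norm_mul, Real.norm_eq_abs K]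
  gcongr
  exact abs_norm_sub_norm_le _ _

variable {f : G → H} {C : ℝ}

theorem memLp_comp_of_polynomial_growth (hm : m ≠ 0) (hf : Continuous f)
    (hgrowth : ∀ y, ‖f y‖ ≤ C * (1 + ‖y‖ ^ m)) {Z : Ω → G} (hZ : MemLp Z (p * m) μ) :
    MemLp (fun ω => f (Z ω)) p μ :=
  ⟨hf.comp_aestronglyMeasurable hZ.1,
    (eLpNorm_le_eLpNorm_pow hm fun ω =>
      norm_le_pow_of_polynomial_growth hm hgrowth (Z ω)).trans_lt
      (ENNReal.pow_lt_top (memLp_const_mul_one_add_norm (max C 1) hZ).2)⟩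

theorem tendsto_eLpNorm_comp_of_polynomial_growth (hm : m ≠ 0) (hf : Continuous f)
    (hgrowth : ∀ y, ‖f y‖ ≤ C * (1 + ‖y‖ ^ m)) (hp : 1 ≤ p) (hp_top : p ≠ ∞)
    {Y : ℕ → Ω → G} {X : Ω → G} (hY : ∀ n, AEStronglyMeasurable (Y n) μ)
    (hX : MemLp X (p * m) μ)
    (hYX : Tendsto (fun n => eLpNorm (Y n - X) (p * m) μ) atTop (𝓝 0)) :
    Tendsto (fun n => eLpNorm ((fun ω => f (Y n ω)) - fun ω => f (X ω)) p μ) atTop (𝓝 0) := by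
  have hpm : 1 ≤ p * m := one_le_mul hp (by exact_mod_cast Nat.one_le_iff_ne_zero.mpr hm)
  have hpm_top : p * m ≠ ∞ := ENNReal.mul_ne_top hp_top (ENNReal.natCast_ne_top m)
  obtain ⟨N, hN⟩ := eventually_atTop.mp (eventually_memLp_of_tendsto_eLpNorm hY hX hYX)
  have hmeasure : TendstoInMeasure μ (fun n ω => f (Y n ω)) atTop fun ω => f (X ω) :=
    tendstoInMeasure_continuous_comp hY
      (tendstoInMeasure_of_tendsto_eLpNorm (one_pos.trans_le hpm).ne' hY hX.1 hYX) hf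
  have hunif : UnifIntegrable (fun n ω => f (Y (n + N) ω)) p μ :=
    unifIntegrable_of_norm_le_pow hm
      (unifIntegrable_const_mul_one_add_norm (max C 1) hpm hpm_top
        (fun n => hN (n + N) (Nat.le_add_left N n)) hX ((tendsto_add_atTop_iff_nat N).mpr hYX))
      fun n ω => norm_le_pow_of_polynomial_growth hm hgrowth (Y (n + N) ω)
  rw [← tendsto_add_atTop_iff_nat N]
  exact tendsto_Lp_finite_of_tendstoInMeasure hp hp_top
    (fun n => hf.comp_aestronglyMeasurable (hY (n + N)))
    (memLp_comp_of_polynomial_growth hm hf hgrowth hX) hunif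
    (hmeasure.comp (tendsto_add_atTop_nat N))

end PolynomialGrowth

section Measurability

variable {Ω : Type u} {mΩ : MeasurableSpace Ω} {d q : ℕ} {T : ℝ} {b : ℝ → E d → E d}
  {σ : ℝ → E d → Matrix (Fin d) (Fin q) ℝ} {W : ℝ → Ω → E q} {μ : Measure Ω} {m : ℕ}

theorem continuous_add_smul_add_toEuclideanLin {β : E d → E d}
    {A : E d → Matrix (Fin d) (Fin q) ℝ} (hβ : Continuous β) (hA : Continuous A) (h : ℝ) :
    Continuous fun z : E d × E q => z.1 + h • β z.1 + Matrix.toEuclideanLin (A z.1) z.2 := by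
  have hdiffusion : Continuous fun z : E d × E q => Matrix.toEuclideanLin (A z.1) z.2 := by
    simp only [Matrix.toLpLin_apply]
    fun_prop
  fun_prop

theorem measurable_eulerGrid {U : ℕ → Ω → E q} {n : ℕ}
    (hb : ∀ k < n, Continuous (b (k * T / m))) (hσ : ∀ k < n, Continuous (σ (k * T / m))) (x : E d)
    (hU : ∀ k < n, Measurable (U (k + 1))) : Measurable (eulerGrid T b σ x m U n) := by
  induction n with
  | zero => exact measurable_const
  | succ n ih =>
    have hY := ih (fun k hk => hb k (by omega)) (fun k hk => hσ k (by omega))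
      fun k hk => hU k (by omega)
    exact (continuous_add_smul_add_toEuclideanLin (hb n n.lt_succ_self) (hσ n n.lt_succ_self)
      (T / m)).measurable.comp (hY.prodMk ((hU n n.lt_succ_self).const_smul √(T / m)))

theorem mul_div_mem_Icc {k : ℕ} (hT : 0 ≤ T) (hk : k ≤ m) : k * T / m ∈ Set.Icc 0 T := by
  refine ⟨by positivity, ?_⟩
  rw [mul_div_right_comm]
  exact mul_le_of_le_one_left hT (div_le_one_of_le₀ (by exact_mod_cast hk) m.cast_nonneg)

theorem measurable_whiteNoise_succ (hT : 0 ≤ T) (hW : ∀ t ∈ Set.Icc 0 T, Measurable (W t)) {k : ℕ}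
    (hk : k < m) : Measurable (whiteNoise T W m (k + 1)) := by
  have hsucc := hW _ (mul_div_mem_Icc hT (Nat.succ_le_of_lt hk))
  have hcurrent := hW _ (mul_div_mem_Icc hT hk.le)
  unfold whiteNoise
  simp only [Nat.cast_succ, add_sub_cancel_right] at hsucc ⊢
  exact (hsucc.sub hcurrent).const_smul √(m / T)

theorem euler_terminal (hT : T ≠ 0) (b : ℝ → E d → E d) (σ : ℝ → E d → Matrix (Fin d) (Fin q) ℝ)
    (x : E d) (W : ℝ → Ω → E q) (m : ℕ) :
    euler T b σ x W m T = eulerGrid T b σ x m (whiteNoise T W m) m := by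
  unfold euler
  rw [mul_div_cancel_left₀ _ hT, Nat.floor_natCast]

theorem measurable_euler_terminal (hT : 0 < T)
    (hb : ContinuousOn (Function.uncurry b) (Set.Icc 0 T ×ˢ Set.univ))
    (hσ : ContinuousOn (Function.uncurry σ) (Set.Icc 0 T ×ˢ Set.univ)) (x : E d)
    (hW : ∀ t ∈ Set.Icc 0 T, Measurable (W t)) (m : ℕ) : Measurable (euler T b σ x W m T) := by
  have hgrid (k : ℕ) (hk : k < m) : (k : ℝ) * T / m ∈ Set.Icc 0 T := mul_div_mem_Icc hT.le hk.le
  rw [euler_terminal hT.ne']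
  exact measurable_eulerGrid
    (fun k hk => continuousOn_univ.mp (hb.uncurry_left _ (hgrid k hk)))
    (fun k hk => continuousOn_univ.mp (hσ.uncurry_left _ (hgrid k hk))) x
    fun k hk => measurable_whiteNoise_succ hT.le hW hk

theorem IsBrownianMotion.measurable {F : Filtration ℝ mΩ} (hW : IsBrownianMotion T F W μ) :
    ∀ t ∈ Set.Icc 0 T, Measurable (W t) :=
  fun t ht => (hW.adapted t ht).mono (F.le t) le_rfl

theorem IsStrongSolution.aestronglyMeasurable {F : Filtration ℝ mΩ} {x : E d} {X : ℝ → Ω → E d}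
    (hX : IsStrongSolution T F W μ b σ x X) (hW : ∀ t ∈ Set.Icc 0 T, Measurable (W t))
    {t : ℝ} (ht : t ∈ Set.Icc 0 T) : AEStronglyMeasurable (X t) μ :=
  (hX.adapted t ht).mono <| iSup₂_le fun s hs => (hW s ⟨hs.1, hs.2.trans ht.2⟩).comap_le

end Measurability

section SupNorm

variable {Ω : Type u} {mΩ : MeasurableSpace Ω} {d : ℕ} {T t : ℝ} {μ : Measure Ω} {p : ℝ≥0∞}

theorem eLpNorm_le_eLpNorm_iSup_enorm (X : ℝ → Ω → E d) (ht : t ∈ Set.Icc 0 T) :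
    eLpNorm (X t) p μ ≤ eLpNorm (fun ω => ⨆ s ∈ Set.Icc 0 T, ‖X s ω‖ₑ) p μ :=
  eLpNorm_mono_enorm fun ω => by
    simpa only [enorm_eq_self] using le_iSup₂_of_le (f := fun s _ => ‖X s ω‖ₑ) t ht le_rfl

variable {Y : ℕ → ℝ → Ω → E d} {X : ℝ → Ω → E d}

theorem TendstoLpSup.memLp (h : TendstoLpSup T μ p Y X) (ht : t ∈ Set.Icc 0 T)
    (hX : AEStronglyMeasurable (X t) μ) : MemLp (X t) p μ :=
  ⟨hX, (eLpNorm_le_eLpNorm_iSup_enorm X ht).trans_lt h.1⟩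

theorem TendstoLpSup.tendsto_eLpNorm (h : TendstoLpSup T μ p Y X) (ht : t ∈ Set.Icc 0 T) :
    Tendsto (fun n => eLpNorm (Y n t - X t) p μ) atTop (𝓝 0) :=
  tendsto_of_tendsto_of_tendsto_of_le_of_le tendsto_const_nhds h.2 (fun _ => zero_le) fun n =>
    eLpNorm_le_eLpNorm_iSup_enorm (fun s ω => Y n s ω - X s ω) ht

end SupNorm

end RichardsonRomberg

open RichardsonRomberg in
theorem proposition1_general {Ω G : Type*} {mΩ : MeasurableSpace Ω} {μ : Measure Ω}
    [IsProbabilityMeasure μ] [NormedAddCommGroup G] {Y : ℕ → Ω → G} {X : Ω → G} {f : G → ℝ}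
    {C : ℝ} {m R : ℕ} {c : ℕ → ℝ} (hm : m ≠ 0) (hf : Continuous f)
    (hgrowth : ∀ y, ‖f y‖ ≤ C * (1 + ‖y‖ ^ m)) (hY : ∀ n, AEStronglyMeasurable (Y n) μ)
    (hX : MemLp X (2 * m) μ) (hYX : Tendsto (fun n => eLpNorm (Y n - X) (2 * m) μ) atTop (𝓝 0))
    (hR : 1 ≤ R)
    (hE : (fun n : ℕ => (∫ ω, f (X ω) ∂μ) - (∫ ω, f (Y n ω) ∂μ)
      - ∑ k ∈ Finset.Icc 1 (R - 1), c k / (n : ℝ) ^ k) =O[atTop] fun n : ℕ => ((n : ℝ) ^ R)⁻¹) :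
    MemLp (fun ω => f (X ω)) 2 μ ∧
    (∀ r ∈ Finset.Icc 1 R, ∀ᶠ n : ℕ in atTop, MemLp (fun ω => f (Y (r * n) ω)) 2 μ) ∧
    ((fun n : ℕ => (∫ ω, ∑ r ∈ Finset.Icc 1 R, weight R r * f (Y (r * n) ω) ∂μ) - ∫ ω, f (X ω) ∂μ)
      =O[atTop] fun n : ℕ => ((n : ℝ) ^ R)⁻¹) ∧
    Tendsto (fun n : ℕ => variance (fun ω => ∑ r ∈ Finset.Icc 1 R, weight R r * f (Y (r * n) ω)) μ)
      atTop (𝓝 (variance (fun ω => f (X ω)) μ)) := by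
  have hfX := memLp_comp_of_polynomial_growth hm hf hgrowth hX
  have hfY (n : ℕ) : AEStronglyMeasurable (fun ω => f (Y n ω)) μ :=
    hf.comp_aestronglyMeasurable (hY n)
  have hlim (r : ℕ) (hr : r ∈ Finset.Icc 1 R) :=
    (tendsto_eLpNorm_comp_of_polynomial_growth hm hf hgrowth one_le_two ENNReal.ofNat_ne_top hY hX
      hYX).comp (tendsto_id.const_mul_atTop' (Finset.mem_Icc.mp hr).1)
  have hmem (r : ℕ) (hr : r ∈ Finset.Icc 1 R) :=
    eventually_memLp_of_tendsto_eLpNorm (fun n => hfY (r * n)) hfX (hlim r hr)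
  refine ⟨hfX, hmem, ?_, ?_⟩
  · refine (isBigO_sum_weight_mul_sub hR hE).congr' ?_ EventuallyEq.rfl
    filter_upwards [(Finset.eventually_all _).mpr hmem] with n hn
    rw [integral_finsetSum _ fun r hr => ((hn r hr).integrable one_le_two).const_mul _]
    simp only [integral_const_mul]
  · refine tendsto_variance_of_tendsto_eLpNorm (fun n => ?_) hfX ?_
    · exact Finset.aestronglyMeasurable_fun_sum _ fun r _ => (hfY (r * n)).const_mul _
    · simpa only [Finset.sum_fn, Pi.smul_def, smul_eq_mul] using
        tendsto_eLpNorm_sum_smul_sub one_le_two (sum_weight hR) (fun r _ n => hfY (r * n)) hfX.1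
          hlim

theorem proposition1 {Ω : Type u} {mΩ : MeasurableSpace Ω} (μ : Measure Ω) [IsProbabilityMeasure μ]
    {d q : ℕ} (T : ℝ) (hT : 0 < T)
    (b : ℝ → RichardsonRomberg.E d → RichardsonRomberg.E d)
    (σ : ℝ → RichardsonRomberg.E d → Matrix (Fin d) (Fin q) ℝ)
    (hb : ContinuousOn (Function.uncurry b) (Set.Icc 0 T ×ˢ Set.univ))
    (hσ : ContinuousOn (Function.uncurry σ) (Set.Icc 0 T ×ˢ Set.univ))
    (x : RichardsonRomberg.E d)
    (F : Filtration ℝ mΩ) (W : ℝ → Ω → RichardsonRomberg.E q)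
    (hW : RichardsonRomberg.IsBrownianMotion T F W μ)
    (X : ℝ → Ω → RichardsonRomberg.E d)
    (hX : RichardsonRomberg.IsStrongSolution T F W μ b σ x X)
    (hLp : ∀ p : ℝ≥0∞, 1 ≤ p → p < ∞ →
      RichardsonRomberg.TendstoLpSup T μ p (fun n => RichardsonRomberg.euler T b σ x W n) X)
    (V : Submodule ℝ (RichardsonRomberg.E d → ℝ))
    (hVchar : RichardsonRomberg.IsCharacterizing.{u} V)
    (hVcont : ∀ f ∈ V, Continuous f)
    (hVgrowth : ∀ f ∈ V, RichardsonRomberg.HasPolynomialGrowth f)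
    (hVmul : ∀ f ∈ V, ∀ g ∈ V, f * g ∈ V)
    (R : ℕ) (hR : 1 ≤ R)
    (hE : RichardsonRomberg.HasWeakExpansion μ V R
      (fun n => RichardsonRomberg.euler T b σ x W n T) (X T))
    (f : RichardsonRomberg.E d → ℝ) (hf : f ∈ V) :
    MemLp (fun ω => f (X T ω)) 2 μ ∧
    (∀ r ∈ Finset.Icc 1 R,
      ∀ᶠ n : ℕ in atTop, MemLp (fun ω => f (RichardsonRomberg.euler T b σ x W (r * n) T ω)) 2 μ) ∧
    ((fun n : ℕ => (∫ ω, RichardsonRomberg.multistep T b σ x W R f n ω ∂μ) - ∫ ω, f (X T ω) ∂μ)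
      =O[atTop] fun n : ℕ => ((n : ℝ) ^ R)⁻¹) ∧
    Tendsto (fun n : ℕ => variance (RichardsonRomberg.multistep T b σ x W R f n) μ) atTop
      (𝓝 (variance (fun ω => f (X T ω)) μ)) := by
  have hTmem : T ∈ Set.Icc 0 T := ⟨hT.le, le_rfl⟩
  obtain ⟨C, m, hm, hgrowth⟩ := (hVgrowth f hf).exists_ne_zero
  obtain ⟨c, hc⟩ := hE f hf
  have hsup := hLp (2 * m) (one_le_mul one_le_two (by exact_mod_cast Nat.one_le_iff_ne_zero.mpr hm))
    (ENNReal.mul_lt_top ENNReal.ofNat_lt_top (ENNReal.natCast_lt_top m))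
  exact proposition1_general hm (hVcont f hf) hgrowth
    (fun n => (RichardsonRomberg.measurable_euler_terminal hT hb hσ x
      hW.measurable n).aestronglyMeasurable)
    (hsup.memLp hTmem (hX.aestronglyMeasurable hW.measurable hTmem)) (hsup.tendsto_eLpNorm hTmem)
    hR hc
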